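/- Let $\mathcal A$ be an abelian category with enough injectives and let $F:\mathcal A\to\mathbf{Ab}$ be an additive covariant functor to abelian groups. For every object $X$ choose a monomorphism $X\to I(X)$ into an injective object, and let $\Sigma X$ be its cokernel, $e_X: I(X)\to\Sigma X$ the projection; put $\Sigma^0X=X$, $\Sigma^{n+1}X=\Sigma(\Sigma^nX)$. Splicing the sequences $0\to\Sigma^nX\to I^n\to\Sigma^{n+1}X\to0$, where $I^n=I(\Sigma^nX)$, gives an injective resolution $0\to X\to I^0\to I^1\to\cdots$. Let $R^nF$ be the right derived functors of $F$, so that $R^nF(X)=H^n(F(I^\bullet))$, and let $\rho_F:F\to R^0F$ be the canonical transformation. Let $\overline F=\operatorname{Ker}\rho_F$; it vanishes on injectives, so that $\overline F\circ\Sigma^n$ is a well-defined functor. Let $S^1F$ be the first right satellite, $S^1F(X)=\operatorname{Coker}\bigl(F(e_X):F(I(X))\to F(\Sigma X)\bigr)$, and let $S^0F=F$ and $S^nF$ ($n\ge1$) be the $n$-fold iterate of $S^1$; there are canonical dimension-shift isomorphisms $S^{n+1}F\cong S^1F\circ\Sigma^n$. The right fundamental sequence of $F$ is the sequence of functors $$0\to\overline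 F\to F\xrightarrow{\rho_F}R^0F\xrightarrow{\beta_F}\overline F\circ\Sigma\to S^1F\to R^1F\to\overline F\circ\Sigma^2\to S^2F\to R^2F\to\cdots$$ where, at an object $X$ and for $n\ge0$: $\overline F\to F$ is the inclusion; $R^nF(X)\to\overline F(\Sigma^{n+1}X)$ is induced by $F(I^n)\to F(\Sigma^{n+1}X)$ (it is $\beta_F$ for $n=0$); $\overline F(\Sigma^{n+1}X)\to S^{n+1}F(X)\cong S^1F(\Sigma^nX)$ is the composite $\overline F(\Sigma^{n+1}X)\to F(\Sigma^{n+1}X)\to S^1F(\Sigma^nX)$; and $S^{n+1}F(X)\cong S^1F(\Sigma^nX)\to R^{n+1}F(X)$ is induced by $F(\Sigma^{n+1}X)\to F(I^{n+1})$. **Theorem 3.1.** 1. The right fundamental sequence is a complex of functors, whose homology is zero except, possibly, at the terms $R^nF$, $n\ge0$. 2. If $F$ is half-exact (for every short exact sequence $0\to A\to B\to C\to0$ the sequence $F(A)\to F(B)\to F(C)$ is exact at $F(B)$), then the right fundamental sequence is exact. 3. If $F$ preserves epimorphisms, then $\beta_F$ is an epimorphism. 4. If $F$ preserves monomorphisms,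 then $\overline F=0$ and $\rho_F$ is a monomorphism. 5. $\rho_F$ is an isomorphism if and only if $F$ is left exact. -/

import Mathlib

open CategoryTheory CategoryTheory.Limits

universe v u w v' u'

set_option linter.unusedSectionVars false

noncomputable section

namespace RightFundamental

/-! ### Cosyzygies with respect to a choice of injective containers -/

section Cosyzygy

open scoped ZeroObject

variable {C : Type u} [Category.{v} C] [Abelian C] (P : ∀ X : C, InjectivePresentation X)

/-- The cosyzygy object `Σ X`: the cokernel of the inclusion of `X` in its injective container. -/
abbrev cosyz (X : C) : C := cokernel (P X).f

/-- The projection `I ⟶ Σ X` of the injective container of `X` onto the cosyzygy object. -/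
def cosyzπ (X : C) : (P X).J ⟶ cosyz P X := cokernel.π (P X).f

instance (X : C) : Epi (cosyzπ P X) := by unfold cosyzπ; infer_instance

lemma f_cosyzπ (X : C) : (P X).f ≫ cosyzπ P X = 0 := cokernel.condition _

/-- An extension of `f : X ⟶ Y` to the injective containers. -/
def containerMap {X Y : C} (f : X ⟶ Y) : (P X).J ⟶ (P Y).J :=
  Injective.factorThru (f ≫ (P Y).f) (P X).f

lemma f_containerMap {X Y : C} (f : X ⟶ Y) :
    (P X).f ≫ containerMap P f = f ≫ (P Y).f := Injective.comp_factorThru _ _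

/-- The morphism of cosyzygy objects induced by the chosen extension of `f : X ⟶ Y`. -/
def cosyzMap {X Y : C} (f : X ⟶ Y) : cosyz P X ⟶ cosyz P Y :=
  cokernel.map _ _ f (containerMap P f) (f_containerMap P f)

lemma cosyzπ_cosyzMap {X Y : C} (f : X ⟶ Y) :
    cosyzπ P X ≫ cosyzMap P f = containerMap P f ≫ cosyzπ P Y := by
  simp [cosyzπ, cosyzMap]

/-- The iterated cosyzygy object `Σⁿ X`. -/
def cosyzIter : ℕ → C → C
  | 0, X => X
  | n + 1, X => cosyz P (cosyzIter n X)

/-- The morphism `Σⁿ X ⟶ Σⁿ Y` induced by the successive chosen extensions of `f : X ⟶ Y`. -/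
def cosyzIterMap : ∀ (n : ℕ) {X Y : C}, (X ⟶ Y) → (cosyzIter P n X ⟶ cosyzIter P n Y)
  | 0, _, _, f => f
  | n + 1, _, _, f => cosyzMap P (cosyzIterMap n f)

/-- Two morphisms are congruent modulo injectives if their difference factors through an
injective object. -/
def StablyEq {X Y : C} (f g : X ⟶ Y) : Prop :=
  ∃ (J : C) (_ : Injective J) (a : X ⟶ J) (b : J ⟶ Y), f = g + a ≫ b

lemma StablyEq.refl {X Y : C} (f : X ⟶ Y) : StablyEq f f :=
  ⟨0, inferInstance, 0, 0, by simp⟩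

/-- A comparison of induced morphisms between cosyzygy objects. -/
lemma cosyz_compare {X Y : C} {f g : X ⟶ Y} (h : StablyEq f g)
    {φ ψ : (P X).J ⟶ (P Y).J} {u v : cosyz P X ⟶ cosyz P Y}
    (hφ : (P X).f ≫ φ = f ≫ (P Y).f) (hψ : (P X).f ≫ ψ = g ≫ (P Y).f)
    (hu : cosyzπ P X ≫ u = φ ≫ cosyzπ P Y) (hv : cosyzπ P X ≫ v = ψ ≫ cosyzπ P Y) :
    ∃ t : cosyz P X ⟶ (P Y).J, u = v + t ≫ cosyzπ P Y := by
  obtain ⟨J, hJ, a, b, rfl⟩ := h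
  let c : (P X).J ⟶ J := Injective.factorThru a (P X).f
  have hc : (P X).f ≫ c = a := Injective.comp_factorThru _ _
  have w : (P X).f ≫ (φ - ψ - c ≫ b ≫ (P Y).f) = 0 := by
    rw [Preadditive.comp_sub, Preadditive.comp_sub, hφ, hψ, reassoc_of% hc]
    simp
  refine ⟨cokernel.desc (P X).f (φ - ψ - c ≫ b ≫ (P Y).f) w, ?_⟩
  have ht : cosyzπ P X ≫ cokernel.desc (P X).f (φ - ψ - c ≫ b ≫ (P Y).f) w =
      φ - ψ - c ≫ b ≫ (P Y).f := cokernel.π_desc _ _ _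
  rw [← cancel_epi (cosyzπ P X), Preadditive.comp_add, hu, hv, reassoc_of% ht]
  simp [f_cosyzπ]

lemma StablyEq.cosyz {X Y : C} {f g : X ⟶ Y} (h : StablyEq f g)
    {φ ψ : (P X).J ⟶ (P Y).J} {u v : cosyz P X ⟶ cosyz P Y}
    (hφ : (P X).f ≫ φ = f ≫ (P Y).f) (hψ : (P X).f ≫ ψ = g ≫ (P Y).f)
    (hu : cosyzπ P X ≫ u = φ ≫ cosyzπ P Y) (hv : cosyzπ P X ≫ v = ψ ≫ cosyzπ P Y) :
    StablyEq u v := by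
  obtain ⟨t, ht⟩ := cosyz_compare P h hφ hψ hu hv
  exact ⟨_, inferInstance, t, _, ht⟩

lemma cosyzIterMap_stablyEq (n : ℕ) {X Y : C} {f g : X ⟶ Y} (h : StablyEq f g) :
    StablyEq (cosyzIterMap P n f) (cosyzIterMap P n g) := by
  induction n with
  | zero => exact h
  | succ n ih =>
    exact ih.cosyz P (f_containerMap P _) (f_containerMap P _)
      (cosyzπ_cosyzMap P _) (cosyzπ_cosyzMap P _)

lemma cosyzIterMap_id (n : ℕ) (X : C) : StablyEq (cosyzIterMap P n (𝟙 X)) (𝟙 _) := by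
  induction n with
  | zero => exact StablyEq.refl _
  | succ n ih =>
    exact ih.cosyz P (ψ := 𝟙 _) (f_containerMap P _) (by simp)
      (cosyzπ_cosyzMap P _) (by erw [Category.comp_id, Category.id_comp])

lemma cosyzIterMap_comp (n : ℕ) {X Y Z : C} (f : X ⟶ Y) (g : Y ⟶ Z) :
    StablyEq (cosyzIterMap P n (f ≫ g)) (cosyzIterMap P n f ≫ cosyzIterMap P n g) := by
  induction n with
  | zero => exact StablyEq.refl _
  | succ n ih =>
    refine ih.cosyz P (ψ := containerMap P (cosyzIterMap P n f) ≫
        containerMap P (cosyzIterMap P n g)) (f_containerMap P _) ?_ (cosyzπ_cosyzMap P _) ?_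
    · rw [reassoc_of% f_containerMap P (cosyzIterMap P n f), f_containerMap, Category.assoc]
    · have h₁ := cosyzπ_cosyzMap P (cosyzIterMap P n f)
      have h₂ := cosyzπ_cosyzMap P (cosyzIterMap P n g)
      simp only [cosyzIterMap, Category.assoc]
      erw [reassoc_of% h₁, h₂]

lemma cosyzIterMap_add (n : ℕ) {X Y : C} (f g : X ⟶ Y) :
    StablyEq (cosyzIterMap P n (f + g)) (cosyzIterMap P n f + cosyzIterMap P n g) := by
  induction n with
  | zero => exact StablyEq.refl _
  | succ n ih =>
    refine ih.cosyz P (ψ := containerMap P (cosyzIterMap P n f) +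
        containerMap P (cosyzIterMap P n g)) (f_containerMap P _) ?_ (cosyzπ_cosyzMap P _) ?_
    · rw [Preadditive.comp_add, f_containerMap, f_containerMap, Preadditive.add_comp]
    · have h₁ := cosyzπ_cosyzMap P (cosyzIterMap P n f)
      have h₂ := cosyzπ_cosyzMap P (cosyzIterMap P n g)
      rw [Preadditive.add_comp, ← h₁, ← h₂, ← Preadditive.comp_add]
      rfl

end Cosyzygy

/-! ### Functors vanishing on injectives, and their composites with `Σⁿ` -/

section Compose

variable {C : Type u} [Category.{v} C] [Abelian C] {D : Type u'} [Category.{v'} D] [Abelian D]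

/-- The functor `G` vanishes on injective objects. -/
class VanishesOnInjectives (G : C ⥤ D) : Prop where
  isZero (J : C) [Injective J] : IsZero (G.obj J)

lemma StablyEq.map_eq {X Y : C} {f g : X ⟶ Y} (h : StablyEq f g) (G : C ⥤ D) [G.Additive]
    [VanishesOnInjectives G] : G.map f = G.map g := by
  obtain ⟨J, hJ, a, b, rfl⟩ := h
  rw [G.map_add, G.map_comp, (VanishesOnInjectives.isZero (G := G) J).eq_of_tgt (G.map a) 0]
  simp

variable (P : ∀ X : C, InjectivePresentation X)

/-- The composite `G ∘ Σⁿ`. Although `Σⁿ` is only an operation on objects and morphisms of `C`,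
this is a functor when `G` is additive and vanishes on injectives. -/
def compCosyz (G : C ⥤ D) [G.Additive] [VanishesOnInjectives G] (n : ℕ) : C ⥤ D where
  obj X := G.obj (cosyzIter P n X)
  map f := G.map (cosyzIterMap P n f)
  map_id X := by rw [(cosyzIterMap_id P n X).map_eq G, G.map_id]
  map_comp f g := by rw [(cosyzIterMap_comp P n f g).map_eq G, G.map_comp]

end Compose

/-! ### Right satellites -/

section Satellite

variable {C : Type u} [Category.{v} C] [Abelian C] {D : Type u'} [Category.{v'} D] [Abelian D]
variable (P : ∀ X : C, InjectivePresentation X)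

lemma firstSatellite_w (F : C ⥤ D) {X Y : C} (f : X ⟶ Y) :
    F.map (cosyzπ P X) ≫ F.map (cosyzMap P f) =
      F.map (containerMap P f) ≫ F.map (cosyzπ P Y) := by
  rw [← F.map_comp, cosyzπ_cosyzMap, F.map_comp]

lemma firstSatellite_aux (F : C ⥤ D) [F.Additive] {X Y : C} {u v : cosyz P X ⟶ cosyz P Y}
    (h : ∃ t : cosyz P X ⟶ (P Y).J, u = v + t ≫ cosyzπ P Y) :
    F.map u ≫ cokernel.π (F.map (cosyzπ P Y)) = F.map v ≫ cokernel.π (F.map (cosyzπ P Y)) := by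
  obtain ⟨t, rfl⟩ := h
  rw [F.map_add, F.map_comp, Preadditive.add_comp, Category.assoc, cokernel.condition]
  simp

/-- The first right satellite `S¹F`: its value at `X` is the cokernel of `F(I) ⟶ F(Σ X)`,
where `I` is the injective container of `X`. -/
def firstSatellite (F : C ⥤ D) [F.Additive] : C ⥤ D where
  obj X := cokernel (F.map (cosyzπ P X))
  map f := cokernel.map _ _ (F.map (containerMap P f)) (F.map (cosyzMap P f))
    (firstSatellite_w P F f)
  map_id X := by
    rw [← cancel_epi (cokernel.π _), cokernel.π_desc, firstSatellite_aux P F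
      (cosyz_compare P (StablyEq.refl (𝟙 X)) (u := cosyzMap P (𝟙 X)) (v := 𝟙 _)
        (ψ := 𝟙 _) (f_containerMap P _) (by simp) (cosyzπ_cosyzMap P _) (by simp))]
    simp
  map_comp {X Y Z} f g := by
    rw [← cancel_epi (cokernel.π _), cokernel.π_desc, firstSatellite_aux P F
      (cosyz_compare P (StablyEq.refl (f ≫ g)) (v := cosyzMap P f ≫ cosyzMap P g)
        (ψ := containerMap P f ≫ containerMap P g) (f_containerMap P _)
        (by rw [reassoc_of% f_containerMap P f, f_containerMap, Category.assoc])
        (cosyzπ_cosyzMap P _)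
        (by rw [reassoc_of% cosyzπ_cosyzMap P f, cosyzπ_cosyzMap, Category.assoc]))]
    simp

/-- The projection `F(Σ X) ⟶ S¹F(X)`. -/
def firstSatelliteπ (F : C ⥤ D) [F.Additive] (X : C) :
    F.obj (cosyz P X) ⟶ (firstSatellite P F).obj X := cokernel.π (F.map (cosyzπ P X))

instance (F : C ⥤ D) [F.Additive] (X : C) : Epi (firstSatelliteπ P F X) := by
  have h : Epi (cokernel.π (F.map (cosyzπ P X))) := inferInstance
  exact h

lemma map_firstSatelliteπ (F : C ⥤ D) [F.Additive] (X : C) :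
    F.map (cosyzπ P X) ≫ firstSatelliteπ P F X = 0 := cokernel.condition _

lemma firstSatelliteπ_map (F : C ⥤ D) [F.Additive] {X Y : C} (f : X ⟶ Y) :
    firstSatelliteπ P F X ≫ (firstSatellite P F).map f =
      F.map (cosyzMap P f) ≫ firstSatelliteπ P F Y := cokernel.π_desc _ _ _

instance (F : C ⥤ D) [F.Additive] : (firstSatellite P F).Additive where
  map_add {X Y f g} := by
    rw [← cancel_epi (firstSatelliteπ P F X), firstSatelliteπ_map, Preadditive.comp_add,
      firstSatelliteπ_map, firstSatelliteπ_map, ← Preadditive.add_comp, ← F.map_add]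
    exact firstSatellite_aux P F
      (cosyz_compare P (StablyEq.refl (f + g)) (v := cosyzMap P f + cosyzMap P g)
        (ψ := containerMap P f + containerMap P g) (f_containerMap P _)
        (by rw [Preadditive.comp_add, f_containerMap, f_containerMap, Preadditive.add_comp])
        (cosyzπ_cosyzMap P _)
        (by rw [Preadditive.comp_add, cosyzπ_cosyzMap, cosyzπ_cosyzMap, Preadditive.add_comp]))

instance (F : C ⥤ D) [F.Additive] : VanishesOnInjectives (firstSatellite P F) where
  isZero J _ := by
    rw [IsZero.iff_id_eq_zero, ← cancel_epi (firstSatelliteπ P F J), Category.comp_id, comp_zero]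
    -- the container of an injective object splits, hence so does its cosyzygy
    have h := cosyz_compare P (f := 𝟙 J) (g := 0) ⟨J, inferInstance, 𝟙 J, 𝟙 J, by simp⟩
      (φ := 𝟙 _) (ψ := 0) (u := 𝟙 _) (v := 0) (by simp) (by simp) (by simp) (by simp)
    have := firstSatellite_aux P F h
    rw [F.map_id, Category.id_comp, F.map_zero, zero_comp] at this
    exact this

/-- The right satellites `SⁿF`, obtained by iterating `S¹`: `S⁰F = F`, `Sⁿ⁺¹F = Sⁿ(S¹F)`. -/
def satellite : ℕ → ∀ (F : C ⥤ D) [F.Additive], C ⥤ D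
  | 0, F, _ => F
  | n + 1, F, _ => satellite n (firstSatellite P F)

instance (G : C ⥤ D) [G.Additive] [VanishesOnInjectives G] (X : C) :
    IsIso (firstSatelliteπ P G X) := by
  have h : G.map (cosyzπ P X) = 0 := (VanishesOnInjectives.isZero (G := G) (P X).J).eq_of_src _ _
  have : Mono (firstSatelliteπ P G X) := Preadditive.mono_of_cancel_zero _ (fun {A} t ht => by
    let r : (firstSatellite P G).obj X ⟶ G.obj (cosyz P X) :=
      cokernel.desc (G.map (cosyzπ P X)) (𝟙 _) (by rw [h, zero_comp])
    have hr : firstSatelliteπ P G X ≫ r = 𝟙 _ := cokernel.π_desc _ _ _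
    rw [← Category.comp_id t, ← hr, reassoc_of% ht, zero_comp])
  exact isIso_of_mono_of_epi _

/-- If `G` vanishes on injectives, then `S¹G(Σⁿ X)` is canonically `G(Σⁿ⁺¹ X)`. -/
def firstSatelliteCompIso (G : C ⥤ D) [G.Additive] [VanishesOnInjectives G] (n : ℕ) :
    compCosyz P (firstSatellite P G) n ≅ compCosyz P G (n + 1) :=
  (NatIso.ofComponents (F := compCosyz P G (n + 1)) (G := compCosyz P (firstSatellite P G) n)
    (fun X => (asIso (firstSatelliteπ P G (cosyzIter P n X)) :
      G.obj (cosyz P (cosyzIter P n X)) ≅ (firstSatellite P G).obj (cosyzIter P n X)))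
    (fun f => (firstSatelliteπ_map P G (cosyzIterMap P n f)).symm)).symm

/-- Dimension shift for the satellites of a functor that vanishes on injectives. -/
def satelliteShiftAux : ∀ (n : ℕ) (G : C ⥤ D) [G.Additive] [VanishesOnInjectives G],
    satellite P n G ≅ compCosyz P G n
  | 0, G, _, _ => NatIso.ofComponents (fun X => Iso.refl (G.obj X))
      (fun _ => (Category.comp_id _).trans (Category.id_comp _).symm)
  | n + 1, G, _, _ => satelliteShiftAux n (firstSatellite P G) ≪≫ firstSatelliteCompIso P G n

/-- Dimension shift for satellites: `Sⁿ⁺¹F ≅ S¹F ∘ Σⁿ`. -/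
def satelliteShift (F : C ⥤ D) [F.Additive] (n : ℕ) :
    satellite P (n + 1) F ≅ compCosyz P (firstSatellite P F) n :=
  satelliteShiftAux P n (firstSatellite P F)

end Satellite

/-! ### The injective resolution built from the chosen containers -/

section Resolution

variable {C : Type u} [Category.{v} C] [Abelian C] (P : ∀ X : C, InjectivePresentation X)

/-- The projection `Iⁿ ⟶ Σⁿ⁺¹ X`, where `Iⁿ` is the container of `Σⁿ X`. -/
def iterπ (n : ℕ) (X : C) : (P (cosyzIter P n X)).J ⟶ cosyzIter P (n + 1) X :=
  cosyzπ P (cosyzIter P n X)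

instance (n : ℕ) (X : C) : Epi (iterπ P n X) :=
  inferInstanceAs (Epi (cosyzπ P (cosyzIter P n X)))

lemma f_iterπ (n : ℕ) (X : C) : (P (cosyzIter P n X)).f ≫ iterπ P n X = 0 := f_cosyzπ P _

lemma iterπ_map (n : ℕ) {X Y : C} (f : X ⟶ Y) :
    iterπ P n X ≫ cosyzIterMap P (n + 1) f =
      containerMap P (cosyzIterMap P n f) ≫ iterπ P n Y := cosyzπ_cosyzMap P _

lemma exact_f_iterπ (n : ℕ) (X : C) : (ShortComplex.mk _ _ (f_iterπ P n X)).Exact :=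
  ShortComplex.exact_cokernel _

/-- The differential `Iⁿ ⟶ Iⁿ⁺¹`, the composite `Iⁿ ⟶ Σⁿ⁺¹ X ⟶ Iⁿ⁺¹`. -/
def resd (n : ℕ) (X : C) : (P (cosyzIter P n X)).J ⟶ (P (cosyzIter P (n + 1) X)).J :=
  iterπ P n X ≫ (P (cosyzIter P (n + 1) X)).f

lemma f_resd (n : ℕ) (X : C) : (P (cosyzIter P n X)).f ≫ resd P n X = 0 := by
  rw [resd, reassoc_of% f_iterπ P n X, zero_comp]

lemma exact_f_resd (n : ℕ) (X : C) : (ShortComplex.mk _ _ (f_resd P n X)).Exact := by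
  let φ : ShortComplex.mk _ _ (f_iterπ P n X) ⟶ ShortComplex.mk _ _ (f_resd P n X) :=
    { τ₁ := 𝟙 _
      τ₂ := 𝟙 _
      τ₃ := (P (cosyzIter P (n + 1) X)).f
      comm₂₃ := by simp [resd] }
  exact (ShortComplex.exact_iff_of_epi_of_isIso_of_mono φ).1 (exact_f_iterπ P n X)

lemma resd_iterπ (n : ℕ) (X : C) : resd P n X ≫ iterπ P (n + 1) X = 0 := by
  rw [resd, Category.assoc, f_iterπ, comp_zero]

lemma resd_resd (n : ℕ) (X : C) : resd P n X ≫ resd P (n + 1) X = 0 := by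
  rw [resd, Category.assoc, f_resd, comp_zero]

lemma exact_resd_resd (n : ℕ) (X : C) : (ShortComplex.mk _ _ (resd_resd P n X)).Exact := by
  let φ : ShortComplex.mk _ _ (resd_resd P n X) ⟶ ShortComplex.mk _ _ (f_resd P (n + 1) X) :=
    { τ₁ := iterπ P n X
      τ₂ := 𝟙 _
      τ₃ := 𝟙 _
      comm₁₂ := by simp [resd] }
  exact (ShortComplex.exact_iff_of_epi_of_isIso_of_mono φ).2 (exact_f_resd P (n + 1) X)

lemma resd_naturality (n : ℕ) {X Y : C} (f : X ⟶ Y) :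
    containerMap P (cosyzIterMap P n f) ≫ resd P n Y =
      resd P n X ≫ containerMap P (cosyzIterMap P (n + 1) f) := by
  rw [resd, resd, Category.assoc, f_containerMap, reassoc_of% iterπ_map P n f]

/-- The complex `I⁰ ⟶ I¹ ⟶ I² ⟶ ⋯`. -/
def resComplex (X : C) : CochainComplex C ℕ :=
  CochainComplex.of (fun n => (P (cosyzIter P n X)).J) (fun n => resd P n X)
    (fun n => resd_resd P n X)

lemma resComplex_d (X : C) (n : ℕ) : (resComplex P X).d n (n + 1) = resd P n X :=
  CochainComplex.of_d (fun n => (P (cosyzIter P n X)).J) (fun n => resd P n X) n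

lemma f_resComplex_d (X : C) :
    (show X ⟶ (resComplex P X).X 0 from (P X).f) ≫ (resComplex P X).d 0 1 = 0 := by
  rw [resComplex_d]; exact f_resd P 0 X

lemma exactAt_resComplex (X : C) (n : ℕ) : (resComplex P X).ExactAt (n + 1) := by
  rw [HomologicalComplex.exactAt_iff' _ n (n + 1) (n + 2) (by simp) (by simp)]
  let e : (resComplex P X).sc' n (n + 1) (n + 2) ≅ ShortComplex.mk _ _ (resd_resd P n X) :=
    ShortComplex.isoMk (Iso.refl (P (cosyzIter P n X)).J)
      (Iso.refl (P (cosyzIter P (n + 1) X)).J) (Iso.refl (P (cosyzIter P (n + 2) X)).J)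
      ((Category.id_comp _).trans ((resComplex_d P X n).symm.trans (Category.comp_id _).symm))
      ((Category.id_comp _).trans
        ((resComplex_d P X (n + 1)).symm.trans (Category.comp_id _).symm))
  exact (ShortComplex.exact_iff_of_iso e).2 (exact_resd_resd P n X)

/-- The injective resolution `0 ⟶ X ⟶ I⁰ ⟶ I¹ ⟶ ⋯`, spliced from the short exact sequences
`0 ⟶ Σⁿ X ⟶ Iⁿ ⟶ Σⁿ⁺¹ X ⟶ 0`. -/
def resolution (X : C) : InjectiveResolution X where
  cocomplex := resComplex P X
  injective n := inferInstanceAs (Injective (P (cosyzIter P n X)).J)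
  ι := (CochainComplex.fromSingle₀Equiv _ _).symm ⟨(P X).f, f_resComplex_d P X⟩
  quasiIso := ⟨fun n => by
    cases n with
    | zero =>
      rw [CochainComplex.quasiIsoAt₀_iff, ShortComplex.quasiIso_iff_of_zeros]
      · refine (ShortComplex.exact_and_mono_f_iff_of_iso ?_).2
          ⟨exact_f_resd P 0 X, inferInstanceAs (Mono (P X).f)⟩
        exact ShortComplex.isoMk (Iso.refl _) (Iso.refl _) (Iso.refl _)
          ((Category.id_comp _).trans ((CochainComplex.fromSingle₀Equiv_symm_apply_f_zero
            (C := resComplex P X) (P X).f (f_resComplex_d P X)).symm.trans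
              (Category.comp_id _).symm))
          ((Category.id_comp _).trans ((resComplex_d P X 0).symm.trans (Category.comp_id _).symm))
      all_goals rfl
    | succ n =>
      rw [quasiIsoAt_iff_exactAt]
      · exact exactAt_resComplex P X n
      · apply CochainComplex.exactAt_succ_single_obj⟩

lemma resolution_ι (X : C) : (resolution P X).ι.f 0 = (P X).f :=
  CochainComplex.fromSingle₀Equiv_symm_apply_f_zero (C := resComplex P X) (P X).f
    (f_resComplex_d P X)

/-- The chain map between the resolutions induced by the successive chosen extensions of `f`. -/
def resolutionMap {X Y : C} (f : X ⟶ Y) : resComplex P X ⟶ resComplex P Y :=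
  CochainComplex.ofHom (X := resComplex P X) (Y := resComplex P Y)
    (fun n => containerMap P (cosyzIterMap P n f))
    (fun n => by
      rw [resComplex_d, resComplex_d]
      exact resd_naturality P n f)

end Resolution

/-! ### The right fundamental sequence -/

section Sequence

variable {C : Type u} [Category.{v} C] [Abelian C] [EnoughInjectives C]
variable {D : Type u'} [Category.{v'} D] [Abelian D] (F : C ⥤ D) [F.Additive]

/-- The sub-stabilization `F̄`: the kernel of the canonical transformation `ρ_F : F ⟶ R⁰F`. -/
def subStab : C ⥤ D := kernel F.toRightDerivedZero

/-- The inclusion `F̄ ⟶ F`. -/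
def subStabι : subStab F ⟶ F := kernel.ι F.toRightDerivedZero

lemma subStabι_toRightDerivedZero : subStabι F ≫ F.toRightDerivedZero = 0 := kernel.condition _

/-- The components of `F̄ ⟶ F` are kernels. -/
def subStabIsKernel (X : C) : IsLimit (KernelFork.ofι ((subStabι F).app X)
    (show (subStabι F).app X ≫ F.toRightDerivedZero.app X = 0 by
      rw [← NatTrans.comp_app, subStabι_toRightDerivedZero]; rfl)) :=
  KernelFork.mapIsLimit (KernelFork.ofι (subStabι F) (subStabι_toRightDerivedZero F))
    (kernelIsKernel F.toRightDerivedZero) ((evaluation C D).obj X)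

instance (X : C) : Mono ((subStabι F).app X) :=
  mono_of_isLimit_fork (subStabIsKernel F X)

instance : (subStab F).Additive where
  map_add {X Y f g} := by
    rw [← cancel_mono ((subStabι F).app Y)]
    simp only [Preadditive.add_comp, NatTrans.naturality, F.map_add, Preadditive.comp_add]

instance : VanishesOnInjectives (subStab F) where
  isZero J _ := by
    have h : (subStabι F).app J ≫ F.toRightDerivedZero.app J = 0 := by
      rw [← NatTrans.comp_app, subStabι_toRightDerivedZero]; rfl
    rw [IsZero.iff_id_eq_zero, ← cancel_mono ((subStabι F).app J),
      ← cancel_mono (F.toRightDerivedZero.app J)]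
    simp [h]

variable (P : ∀ X : C, InjectivePresentation X)

/-- The complex `F(I⁰) ⟶ F(I¹) ⟶ F(I²) ⟶ ⋯`. -/
abbrev mapRes (X : C) : CochainComplex D ℕ :=
  (F.mapHomologicalComplex _).obj (resComplex P X)

lemma mapRes_d (X : C) (n : ℕ) : (mapRes F P X).d n (n + 1) = F.map (resd P n X) :=
  congrArg F.map (resComplex_d P X n)

/-- The morphism `F(Σⁿ X) ⟶ F(Iⁿ)`. -/
def mapι (n : ℕ) (X : C) : F.obj (cosyzIter P n X) ⟶ (mapRes F P X).X n :=
  F.map (P (cosyzIter P n X)).f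

/-- The morphism `F(Iⁿ) ⟶ F(Σⁿ⁺¹ X)`. -/
def mapπ (n : ℕ) (X : C) : (mapRes F P X).X n ⟶ F.obj (cosyzIter P (n + 1) X) :=
  F.map (iterπ P n X)

lemma mapπ_mapι (n : ℕ) (X : C) :
    mapπ F P n X ≫ mapι F P (n + 1) X = (mapRes F P X).d n (n + 1) :=
  (F.map_comp _ _).symm.trans (mapRes_d F P X n).symm

lemma mapι_mapπ (n : ℕ) (X : C) : mapι F P n X ≫ mapπ F P n X = 0 :=
  (F.map_comp _ _).symm.trans ((congrArg F.map (f_iterπ P n X)).trans (F.map_zero _ _))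

lemma mapι_d (n : ℕ) (X : C) : mapι F P n X ≫ (mapRes F P X).d n (n + 1) = 0 := by
  rw [← mapπ_mapι, reassoc_of% mapι_mapπ F P, zero_comp]

lemma d_mapπ (n : ℕ) (X : C) : (mapRes F P X).d n (n + 1) ≫ mapπ F P (n + 1) X = 0 := by
  rw [← mapπ_mapι, Category.assoc, mapι_mapπ, comp_zero]

lemma prev_mapπ (n : ℕ) (X : C) :
    (mapRes F P X).d ((ComplexShape.up ℕ).prev n) n ≫ mapπ F P n X = 0 := by
  cases n with
  | zero => rw [HomologicalComplex.shape _ _ _ (by simp), zero_comp]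
  | succ n =>
    have h : (ComplexShape.up ℕ).prev (n + 1) = n := by simp
    rw [h, d_mapπ]

/-- The chain map `F(I⁰ ⟶ I¹ ⟶ ⋯) ⟶ F(J⁰ ⟶ J¹ ⟶ ⋯)` induced by `f : X ⟶ Y`. -/
abbrev mapResMap {X Y : C} (f : X ⟶ Y) : mapRes F P X ⟶ mapRes F P Y :=
  (F.mapHomologicalComplex _).map (resolutionMap P f)

lemma mapι_naturality (n : ℕ) {X Y : C} (f : X ⟶ Y) :
    mapι F P n X ≫ (mapResMap F P f).f n = F.map (cosyzIterMap P n f) ≫ mapι F P n Y :=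
  (F.map_comp _ _).symm.trans ((congrArg F.map (f_containerMap P _)).trans (F.map_comp _ _))

lemma mapπ_naturality (n : ℕ) {X Y : C} (f : X ⟶ Y) :
    mapπ F P n X ≫ F.map (cosyzIterMap P (n + 1) f) = (mapResMap F P f).f n ≫ mapπ F P n Y :=
  (F.map_comp _ _).symm.trans ((congrArg F.map (iterπ_map P n f)).trans (F.map_comp _ _))

/-- The identification of `RⁿF(X)` with the cohomology of `F(I⁰) ⟶ F(I¹) ⟶ F(I²) ⟶ ⋯`. -/
def rightDerivedIso (n : ℕ) (X : C) :
    (F.rightDerived n).obj X ≅ (mapRes F P X).homology n :=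
  (resolution P X).isoRightDerivedObj F n

lemma rightDerivedIso_naturality (n : ℕ) {X Y : C} (f : X ⟶ Y) :
    (F.rightDerived n).map f ≫ (rightDerivedIso F P n Y).hom =
      (rightDerivedIso F P n X).hom ≫ HomologicalComplex.homologyMap (mapResMap F P f) n :=
  InjectiveResolution.isoRightDerivedObj_hom_naturality f (resolution P X) (resolution P Y)
    (resolutionMap P f) (by
      rw [resolution_ι, resolution_ι]
      exact f_containerMap P f) F n

/-- A morphism to `F(X)` which becomes zero in `F(I)`, where `I` is the container of `X`, is
killed by `ρ_F`. -/
lemma comp_toRightDerivedZero_eq_zero {A : D} {X : C} (t : A ⟶ F.obj X)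
    (ht : t ≫ F.map (P X).f = 0) : t ≫ F.toRightDerivedZero.app X = 0 := by
  have h : t ≫ (resolution P X).toRightDerivedZero' F = 0 := by
    rw [← cancel_mono (HomologicalComplex.iCycles _ _), Category.assoc,
      InjectiveResolution.toRightDerivedZero'_comp_iCycles, zero_comp, resolution_ι]
    exact ht
  rw [(resolution P X).toRightDerivedZero_eq F, reassoc_of% h, zero_comp]

/-- The morphism to `F̄(X)` given by a morphism to `F(X)` which becomes zero in `F(I)`. -/
def subStabLift {A : D} {X : C} (t : A ⟶ F.obj X) (ht : t ≫ F.map (P X).f = 0) :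
    A ⟶ (subStab F).obj X :=
  (KernelFork.IsLimit.lift' (subStabIsKernel F X) t
    (comp_toRightDerivedZero_eq_zero F P t ht)).1

lemma subStabLift_ι {A : D} {X : C} (t : A ⟶ F.obj X) (ht : t ≫ F.map (P X).f = 0) :
    subStabLift F P t ht ≫ (subStabι F).app X = t :=
  (KernelFork.IsLimit.lift' (subStabIsKernel F X) t
    (comp_toRightDerivedZero_eq_zero F P t ht)).2

/-- The projection `F(Σⁿ⁺¹ X) ⟶ S¹F(Σⁿ X)`. -/
def iterSatelliteπ (n : ℕ) (X : C) :
    F.obj (cosyzIter P (n + 1) X) ⟶ (firstSatellite P F).obj (cosyzIter P n X) :=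
  firstSatelliteπ P F (cosyzIter P n X)

instance (n : ℕ) (X : C) : Epi (iterSatelliteπ F P n X) :=
  inferInstanceAs (Epi (firstSatelliteπ P F (cosyzIter P n X)))

lemma iterSatelliteπ_map (n : ℕ) {X Y : C} (f : X ⟶ Y) :
    iterSatelliteπ F P n X ≫ (firstSatellite P F).map (cosyzIterMap P n f) =
      F.map (cosyzIterMap P (n + 1) f) ≫ iterSatelliteπ F P n Y :=
  firstSatelliteπ_map P F (cosyzIterMap P n f)

/-- The transformation `F̄ ∘ Σⁿ⁺¹ ⟶ S¹F ∘ Σⁿ` with components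
`F̄(Σⁿ⁺¹ X) ⟶ F(Σⁿ⁺¹ X) ⟶ S¹F(Σⁿ X)`. -/
def subStabToFirstSatellite (n : ℕ) :
    compCosyz P (subStab F) (n + 1) ⟶ compCosyz P (firstSatellite P F) n where
  app X := (subStabι F).app (cosyzIter P (n + 1) X) ≫ iterSatelliteπ F P n X
  naturality X Y f := by
    change (subStab F).map (cosyzIterMap P (n + 1) f) ≫ (subStabι F).app _ ≫ _ =
      ((subStabι F).app _ ≫ _) ≫ (firstSatellite P F).map (cosyzIterMap P n f)
    rw [Category.assoc, iterSatelliteπ_map, NatTrans.naturality_assoc]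

/-- The transformation `F̄ ∘ Σⁿ ⟶ SⁿF` of the fundamental sequence. For `n = 0` it is the
inclusion `F̄ ⟶ F`; for `n + 1` it is, up to dimension shift, the composite
`F̄(Σⁿ⁺¹ X) ⟶ F(Σⁿ⁺¹ X) ⟶ S¹F(Σⁿ X)`. -/
def toSatellite : ∀ n : ℕ, compCosyz P (subStab F) n ⟶ satellite P n F
  | 0 => { app := fun X => (subStabι F).app X
           naturality := fun _ _ f => (subStabι F).naturality f }
  | n + 1 => subStabToFirstSatellite F P n ≫ (satelliteShift P F n).inv

/-- The morphism `F(Σⁿ⁺¹ X) ⟶ Zⁿ⁺¹`, where `Zⁿ⁺¹` is the kernel of `F(Iⁿ⁺¹) ⟶ F(Iⁿ⁺²)`. -/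
def toCyclesRes (n : ℕ) (X : C) :
    F.obj (cosyzIter P (n + 1) X) ⟶ (mapRes F P X).cycles (n + 1) :=
  (mapRes F P X).liftCycles (mapι F P (n + 1) X) (n + 2) (by simp) (mapι_d F P (n + 1) X)

lemma toCyclesRes_i (n : ℕ) (X : C) :
    toCyclesRes F P n X ≫ (mapRes F P X).iCycles (n + 1) = mapι F P (n + 1) X :=
  HomologicalComplex.liftCycles_i _ _ _ _ _

lemma mapπ_toCyclesRes (n : ℕ) (X : C) :
    mapπ F P n X ≫ toCyclesRes F P n X = (mapRes F P X).toCycles n (n + 1) := by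
  rw [← cancel_mono ((mapRes F P X).iCycles (n + 1)), Category.assoc, toCyclesRes_i,
    HomologicalComplex.toCycles_i, mapπ_mapι]

lemma mapπ_toCyclesRes_homologyπ (n : ℕ) (X : C) :
    mapπ F P n X ≫ toCyclesRes F P n X ≫ (mapRes F P X).homologyπ (n + 1) = 0 := by
  rw [reassoc_of% mapπ_toCyclesRes F P, HomologicalComplex.toCycles_comp_homologyπ]

/-- The morphism `S¹F(Σⁿ X) ⟶ Hⁿ⁺¹(F(I⁰) ⟶ F(I¹) ⟶ ⋯)` induced by `F(Σⁿ⁺¹ X) ⟶ Zⁿ⁺¹`. -/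
def firstSatelliteToHomology (n : ℕ) (X : C) :
    (firstSatellite P F).obj (cosyzIter P n X) ⟶ (mapRes F P X).homology (n + 1) :=
  cokernel.desc (F.map (cosyzπ P (cosyzIter P n X)))
    (toCyclesRes F P n X ≫ (mapRes F P X).homologyπ (n + 1)) (mapπ_toCyclesRes_homologyπ F P n X)

lemma iterSatelliteπ_toHomology (n : ℕ) (X : C) :
    iterSatelliteπ F P n X ≫ firstSatelliteToHomology F P n X =
      toCyclesRes F P n X ≫ (mapRes F P X).homologyπ (n + 1) :=
  cokernel.π_desc _ _ _

lemma toCyclesRes_naturality (n : ℕ) {X Y : C} (f : X ⟶ Y) :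
    toCyclesRes F P n X ≫ HomologicalComplex.cyclesMap (mapResMap F P f) (n + 1) =
      F.map (cosyzIterMap P (n + 1) f) ≫ toCyclesRes F P n Y := by
  rw [← cancel_mono ((mapRes F P Y).iCycles (n + 1)), Category.assoc, Category.assoc,
    HomologicalComplex.cyclesMap_i, reassoc_of% toCyclesRes_i F P, toCyclesRes_i, mapι_naturality]

lemma firstSatelliteToHomology_naturality (n : ℕ) {X Y : C} (f : X ⟶ Y) :
    (firstSatellite P F).map (cosyzIterMap P n f) ≫ firstSatelliteToHomology F P n Y =
      firstSatelliteToHomology F P n X ≫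
        HomologicalComplex.homologyMap (mapResMap F P f) (n + 1) := by
  rw [← cancel_epi (iterSatelliteπ F P n X), reassoc_of% iterSatelliteπ_map F P,
    iterSatelliteπ_toHomology, reassoc_of% iterSatelliteπ_toHomology F P,
    HomologicalComplex.homologyπ_naturality, reassoc_of% toCyclesRes_naturality F P]

lemma firstSatelliteToRightDerived_naturality (n : ℕ) {X Y : C} (f : X ⟶ Y) :
    (firstSatellite P F).map (cosyzIterMap P n f) ≫
        firstSatelliteToHomology F P n Y ≫ (rightDerivedIso F P (n + 1) Y).inv =
      (firstSatelliteToHomology F P n X ≫ (rightDerivedIso F P (n + 1) X).inv) ≫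
        (F.rightDerived (n + 1)).map f := by
  rw [← cancel_mono (rightDerivedIso F P (n + 1) Y).hom, Category.assoc, Category.assoc,
    Category.assoc, Category.assoc, Iso.inv_hom_id, Category.comp_id,
    rightDerivedIso_naturality, Iso.inv_hom_id_assoc, firstSatelliteToHomology_naturality]

/-- The transformation `S¹F ∘ Σⁿ ⟶ Rⁿ⁺¹F` induced by `F(Σⁿ⁺¹ X) ⟶ F(Iⁿ⁺¹)`. -/
def firstSatelliteToRightDerived (n : ℕ) :
    compCosyz P (firstSatellite P F) n ⟶ F.rightDerived (n + 1) where
  app X := firstSatelliteToHomology F P n X ≫ (rightDerivedIso F P (n + 1) X).inv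
  naturality _ _ f := firstSatelliteToRightDerived_naturality F P n f

/-- The transformation `SⁿF ⟶ RⁿF` of the fundamental sequence. For `n = 0` it is
`ρ_F : F ⟶ R⁰F`; for `n + 1` it is, up to dimension shift, induced by `F(Σⁿ⁺¹ X) ⟶ F(Iⁿ⁺¹)`. -/
def toRightDerived : ∀ n : ℕ, satellite P n F ⟶ F.rightDerived n
  | 0 => F.toRightDerivedZero
  | n + 1 => (satelliteShift P F n).hom ≫ firstSatelliteToRightDerived F P n

/-- The morphism `Hⁿ(F(I⁰) ⟶ F(I¹) ⟶ ⋯) ⟶ F(Σⁿ⁺¹ X)` induced by `F(Iⁿ) ⟶ F(Σⁿ⁺¹ X)`. -/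
def homologyToCosyz (n : ℕ) (X : C) :
    (mapRes F P X).homology n ⟶ F.obj (cosyzIter P (n + 1) X) :=
  (mapRes F P X).homologyι n ≫
    (mapRes F P X).descOpcycles (mapπ F P n X) _ rfl (prev_mapπ F P n X)

lemma homologyπ_homologyToCosyz (n : ℕ) (X : C) :
    (mapRes F P X).homologyπ n ≫ homologyToCosyz F P n X =
      (mapRes F P X).iCycles n ≫ mapπ F P n X := by
  rw [homologyToCosyz, HomologicalComplex.homology_π_ι_assoc, HomologicalComplex.p_descOpcycles]

lemma homologyToCosyz_mapι (n : ℕ) (X : C) :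
    homologyToCosyz F P n X ≫ mapι F P (n + 1) X = 0 := by
  rw [← cancel_epi ((mapRes F P X).homologyπ n), reassoc_of% homologyπ_homologyToCosyz F P, mapπ_mapι,
    HomologicalComplex.iCycles_d, comp_zero]

lemma homologyToCosyz_naturality (n : ℕ) {X Y : C} (f : X ⟶ Y) :
    HomologicalComplex.homologyMap (mapResMap F P f) n ≫ homologyToCosyz F P n Y =
      homologyToCosyz F P n X ≫ F.map (cosyzIterMap P (n + 1) f) := by
  rw [← cancel_epi ((mapRes F P X).homologyπ n), HomologicalComplex.homologyπ_naturality_assoc,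
    homologyπ_homologyToCosyz, reassoc_of% homologyπ_homologyToCosyz F P,
    HomologicalComplex.cyclesMap_i_assoc, mapπ_naturality]

/-- The morphism `RⁿF(X) ⟶ F̄(Σⁿ⁺¹ X)` induced by `F(Iⁿ) ⟶ F(Σⁿ⁺¹ X)`. -/
def connectingApp (n : ℕ) (X : C) :
    (F.rightDerived n).obj X ⟶ (subStab F).obj (cosyzIter P (n + 1) X) :=
  (rightDerivedIso F P n X).hom ≫
    subStabLift F P (homologyToCosyz F P n X) (homologyToCosyz_mapι F P n X)

lemma connectingApp_ι (n : ℕ) (X : C) :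
    connectingApp F P n X ≫ (subStabι F).app _ =
      (rightDerivedIso F P n X).hom ≫ homologyToCosyz F P n X := by
  rw [connectingApp, Category.assoc]
  exact congrArg ((rightDerivedIso F P n X).hom ≫ ·) (subStabLift_ι F P _ _)

lemma connectingApp_naturality (n : ℕ) {X Y : C} (f : X ⟶ Y) :
    (F.rightDerived n).map f ≫ connectingApp F P n Y =
      connectingApp F P n X ≫ (subStab F).map (cosyzIterMap P (n + 1) f) := by
  rw [← cancel_mono ((subStabι F).app (cosyzIter P (n + 1) Y)), Category.assoc, Category.assoc,
    NatTrans.naturality, connectingApp_ι, reassoc_of% connectingApp_ι F P, ← homologyToCosyz_naturality,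
    ← Category.assoc, rightDerivedIso_naturality, Category.assoc]

/-- The connecting transformation `RⁿF ⟶ F̄ ∘ Σⁿ⁺¹` of the fundamental sequence, induced by
`F(Iⁿ) ⟶ F(Σⁿ⁺¹ X)`. For `n = 0` it is `β_F : R⁰F ⟶ F̄ ∘ Σ`. -/
def connecting (n : ℕ) : F.rightDerived n ⟶ compCosyz P (subStab F) (n + 1) where
  app X := connectingApp F P n X
  naturality _ _ f := connectingApp_naturality F P n f

/-- `F` is half-exact: it takes a short exact sequence `0 ⟶ A ⟶ B ⟶ C ⟶ 0` to a sequence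
`F(A) ⟶ F(B) ⟶ F(C)` which is exact at `F(B)`. -/
def HalfExact (F : C ⥤ D) [F.Additive] : Prop :=
  ∀ S : ShortComplex C, S.ShortExact → (S.map F).Exact

end Sequence

end RightFundamental

end

/-! Everything is checked objectwise and reduces to the maps `F(Σⁿ X) ⟶ F(Iⁿ) ⟶ F(Σⁿ⁺¹ X)`. In these
terms `F̄(Σⁿ X)` is the kernel of `F(Σⁿ X) ⟶ F(Iⁿ)`, `Sⁿ⁺¹F(X)` is the cokernel of `F(Iⁿ) ⟶ F(Σⁿ⁺¹
X)`, and `RⁿF(X)` is cycles modulo boundaries in `F(I•)`. The lemmas `toSatelliteApp_eq`,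
`satelliteπ_toRightDerived` and `connectingApp_ι` express the three kinds of arrows this way, and
short diagram chases (with elements up to refinement) do the rest.

A section of `F̄(Σⁿ⁺¹ X)` that dies in `Sⁿ⁺¹F` comes from `F(Iⁿ)`, necessarily from a cycle. A
section of `F(Σⁿ⁺¹ X)` that becomes a boundary can be corrected by something from `F(Iⁿ)` so as to
lie in `F̄`. A cycle of `F(Iⁿ)` that dies in `F(Σⁿ⁺¹ X)` need not come from `F(Σⁿ X)`:
half-exactness says exactly that it does.

If `ρ_F` is an isomorphism, then `F(X)` is the kernel of `F(J) ⟶ F(J/X)` for every embedding of `X`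
in an injective `J`. For `0 ⟶ A ⟶ B ⟶ C ⟶ 0`, embedding `B` in such a `J` embeds `A` too, and
comparing the two kernels in `F(J)` gives left exactness. -/

namespace RightFundamental

section Pointwise

variable {C : Type u} [Category.{v} C] {D : Type u'} [Category.{v'} D] [Abelian D]

/-- Exactness in a functor category is checked objectwise. -/
lemma exact_of_exact_evaluation (S : ShortComplex (C ⥤ D))
    (h : ∀ X, (S.map ((evaluation C D).obj X)).Exact) : S.Exact := by
  rw [ShortComplex.exact_iff_isZero_homology]
  refine Functor.isZero _ fun X => ?_
  exact ((ShortComplex.exact_iff_isZero_homology _).1 (h X)).of_iso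
    (S.mapHomologyIso ((evaluation C D).obj X)).symm

end Pointwise

/-! ### The terms as subobjects and quotients of `F(Σⁿ X)` and `F(Iⁿ)` -/

section Sequence

variable {C : Type u} [Category.{v} C] [Abelian C] [EnoughInjectives C]
variable {D : Type u'} [Category.{v'} D] [Abelian D] (F : C ⥤ D) [F.Additive]

/-- By naturality the composite factors through `F̄(J) = 0`. With `subStabLift` this makes `F̄(X)`
the kernel of `F(X) ⟶ F(I)`. -/
lemma subStabι_map_injective {X J : C} [Injective J] (f : X ⟶ J) :
    (subStabι F).app X ≫ F.map f = 0 := by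
  rw [← NatTrans.naturality,
    (VanishesOnInjectives.isZero (G := subStab F) J).eq_of_tgt ((subStab F).map f) 0, zero_comp]

variable (P : ∀ X : C, InjectivePresentation X)

lemma subStabι_mapι (n : ℕ) (X : C) :
    (subStabι F).app (cosyzIter P n X) ≫ mapι F P n X = 0 :=
  subStabι_map_injective F (P (cosyzIter P n X)).f

/-- The morphism `F(Σⁿ X) ⟶ Zⁿ`, where `Zⁿ` is the kernel of `F(Iⁿ) ⟶ F(Iⁿ⁺¹)`. -/
noncomputable def toCycles (n : ℕ) (X : C) :
    F.obj (cosyzIter P n X) ⟶ (mapRes F P X).cycles n :=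
  (mapRes F P X).liftCycles (mapι F P n X) (n + 1) (by simp) (mapι_d F P n X)

lemma toCycles_i (n : ℕ) (X : C) :
    toCycles F P n X ≫ (mapRes F P X).iCycles n = mapι F P n X :=
  HomologicalComplex.liftCycles_i _ _ _ _ _

lemma mapπ_toCycles (n : ℕ) (X : C) :
    mapπ F P n X ≫ toCycles F P (n + 1) X = (mapRes F P X).toCycles n (n + 1) :=
  mapπ_toCyclesRes F P n X

/-- The inverse `S¹F(Σⁿ X) ⟶ Sⁿ⁺¹F(X)` of the dimension shift. -/
noncomputable def satelliteShiftInv (n : ℕ) (X : C) :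
    (firstSatellite P F).obj (cosyzIter P n X) ⟶ (satellite P (n + 1) F).obj X :=
  (satelliteShift P F n).inv.app X

instance isIso_satelliteShiftInv (n : ℕ) (X : C) : IsIso (satelliteShiftInv F P n X) :=
  inferInstanceAs (IsIso ((satelliteShift P F n).app X).inv)

lemma satelliteShiftInv_toRightDerived (n : ℕ) (X : C) :
    satelliteShiftInv F P n X ≫ (toRightDerived F P (n + 1)).app X =
      firstSatelliteToHomology F P n X ≫ (rightDerivedIso F P (n + 1) X).inv :=
  Iso.inv_hom_id_app_assoc (satelliteShift P F n) X
    ((firstSatelliteToRightDerived F P n).app X)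

/-- The canonical epimorphism `F(Σⁿ X) ⟶ SⁿF(X)`. -/
noncomputable def satelliteπ : ∀ (n : ℕ) (X : C),
    F.obj (cosyzIter P n X) ⟶ (satellite P n F).obj X
  | 0, X => 𝟙 (F.obj X)
  | n + 1, X => iterSatelliteπ F P n X ≫ satelliteShiftInv F P n X

lemma satelliteπ_succ (n : ℕ) (X : C) :
    satelliteπ F P (n + 1) X = iterSatelliteπ F P n X ≫ satelliteShiftInv F P n X := rfl

instance epi_satelliteπ (n : ℕ) (X : C) : Epi (satelliteπ F P n X) := by
  cases n with
  | zero => exact inferInstanceAs (Epi (𝟙 (F.obj X)))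
  | succ n =>
    rw [satelliteπ_succ]
    infer_instance

/-- The morphism `F̄(Σⁿ X) ⟶ SⁿF(X)` of the fundamental sequence. -/
noncomputable def toSatelliteApp (n : ℕ) (X : C) :
    (subStab F).obj (cosyzIter P n X) ⟶ (satellite P n F).obj X :=
  (toSatellite F P n).app X

/-- Hides the dimension shift and the split between `n = 0` and `n + 1` from the later chases. -/
lemma toSatelliteApp_eq (n : ℕ) (X : C) :
    toSatelliteApp F P n X = (subStabι F).app (cosyzIter P n X) ≫ satelliteπ F P n X := by
  cases n with
  | zero => exact (Category.comp_id ((subStabι F).app X)).symm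
  | succ n =>
    rw [satelliteπ_succ, ← Category.assoc]
    rfl

/-- Both maps become `F(X) ⟶ F(I⁰)` after the monomorphism `Z⁰ ⟶ F(I⁰)`. This ties the abstract
`ρ_F` to the chosen containers. -/
lemma toRightDerivedZero'_resolution (X : C) :
    (resolution P X).toRightDerivedZero' F = toCycles F P 0 X :=
  (cancel_mono ((mapRes F P X).iCycles 0)).1
    (((resolution P X).toRightDerivedZero'_comp_iCycles F).trans
      ((congrArg F.map (resolution_ι P X)).trans (toCycles_i F P 0 X).symm))

lemma toRightDerivedZero_app_isoRightDerivedObj {X : C} (I : InjectiveResolution X) :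
    F.toRightDerivedZero.app X ≫ (I.isoRightDerivedObj F 0).hom =
      I.toRightDerivedZero' F ≫ (CochainComplex.isoHomologyπ₀ _).hom :=
  (Iso.eq_comp_inv _).1 ((I.toRightDerivedZero_eq F).trans (Category.assoc _ _ _).symm)

/-- Since `satelliteπ` is an epimorphism, this determines `SⁿF ⟶ RⁿF` by the concrete map `F(Σⁿ X) ⟶
Zⁿ ⟶ Hⁿ`, uniformly in `n`. -/
lemma satelliteπ_toRightDerived (n : ℕ) (X : C) :
    satelliteπ F P n X ≫ (toRightDerived F P n).app X ≫ (rightDerivedIso F P n X).hom =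
      toCycles F P n X ≫ (mapRes F P X).homologyπ n := by
  cases n with
  | zero =>
    exact (Category.id_comp _).trans
      ((toRightDerivedZero_app_isoRightDerivedObj F (resolution P X)).trans
        (congrArg (· ≫ (mapRes F P X).homologyπ 0) (toRightDerivedZero'_resolution F P X)))
  | succ n =>
    rw [satelliteπ_succ, Category.assoc, reassoc_of% satelliteShiftInv_toRightDerived F P n X,
      Iso.inv_hom_id, Category.comp_id, iterSatelliteπ_toHomology]
    rfl

lemma mapπ_iterSatelliteπ (n : ℕ) (X : C) : mapπ F P n X ≫ iterSatelliteπ F P n X = 0 :=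
  map_firstSatelliteπ P F _

lemma mapπ_satelliteπ (n : ℕ) (X : C) : mapπ F P n X ≫ satelliteπ F P (n + 1) X = 0 := by
  rw [satelliteπ_succ, reassoc_of% mapπ_iterSatelliteπ F P n X, zero_comp]

lemma exact_mapπ_satelliteπ (n : ℕ) (X : C) :
    (ShortComplex.mk _ _ (mapπ_satelliteπ F P n X)).Exact := by
  -- `S¹F(Σⁿ X)` is a cokernel by construction; the dimension shift is an isomorphism, so it does
  -- not affect exactness.
  let φ : ShortComplex.mk _ _ (mapπ_iterSatelliteπ F P n X) ⟶
      ShortComplex.mk _ _ (mapπ_satelliteπ F P n X) :=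
    { τ₁ := 𝟙 _
      τ₂ := 𝟙 _
      τ₃ := satelliteShiftInv F P n X
      comm₂₃ := by simp [satelliteπ_succ] }
  exact (ShortComplex.exact_iff_of_epi_of_isIso_of_mono φ).1
    (ShortComplex.exact_cokernel (F.map (cosyzπ P (cosyzIter P n X))))

/-! ### Consecutive arrows compose to zero -/

lemma toCycles_homologyToCosyz (n : ℕ) (X : C) :
    toCycles F P n X ≫ (mapRes F P X).homologyπ n ≫ homologyToCosyz F P n X = 0 := by
  rw [homologyπ_homologyToCosyz, reassoc_of% toCycles_i F P, mapι_mapπ]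

/-- `F̄(Σⁿ X)` already dies in `F(Iⁿ)`, hence in its subobject `Zⁿ`. -/
lemma toSatelliteApp_toRightDerived (n : ℕ) (X : C) :
    toSatelliteApp F P n X ≫ (toRightDerived F P n).app X = 0 := by
  have h : (subStabι F).app (cosyzIter P n X) ≫ toCycles F P n X = 0 := by
    rw [← cancel_mono ((mapRes F P X).iCycles n), Category.assoc, toCycles_i, subStabι_mapι,
      zero_comp]
  rw [← cancel_mono (rightDerivedIso F P n X).hom, toSatelliteApp_eq,
    Category.assoc, Category.assoc, satelliteπ_toRightDerived, reassoc_of% h, zero_comp, zero_comp]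

lemma toRightDerived_connectingApp (n : ℕ) (X : C) :
    (toRightDerived F P n).app X ≫ connectingApp F P n X = 0 := by
  rw [← cancel_epi (satelliteπ F P n X),
    ← cancel_mono ((subStabι F).app (cosyzIter P (n + 1) X)),
    Category.assoc, Category.assoc, connectingApp_ι,
    reassoc_of% satelliteπ_toRightDerived F P n X, toCycles_homologyToCosyz, comp_zero, zero_comp]

lemma connectingApp_toSatelliteApp (n : ℕ) (X : C) :
    connectingApp F P n X ≫ toSatelliteApp F P (n + 1) X = 0 := by
  rw [toSatelliteApp_eq, reassoc_of% connectingApp_ι F P n X,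
    ← cancel_epi (rightDerivedIso F P n X).inv, Iso.inv_hom_id_assoc,
    ← cancel_epi ((mapRes F P X).homologyπ n), reassoc_of% homologyπ_homologyToCosyz F P n X,
    mapπ_satelliteπ, comp_zero, comp_zero, comp_zero]

theorem toSatellite_toRightDerived (n : ℕ) : toSatellite F P n ≫ toRightDerived F P n = 0 :=
  NatTrans.ext (funext fun X => toSatelliteApp_toRightDerived F P n X)

theorem toRightDerived_connecting (n : ℕ) : toRightDerived F P n ≫ connecting F P n = 0 :=
  NatTrans.ext (funext fun X => toRightDerived_connectingApp F P n X)

theorem connecting_toSatellite (n : ℕ) : connecting F P n ≫ toSatellite F P (n + 1) = 0 :=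
  NatTrans.ext (funext fun X => connectingApp_toSatelliteApp F P n X)

/-! ### Objectwise exactness -/

lemma exact_connectingApp_toSatelliteApp (n : ℕ) (X : C) :
    (ShortComplex.mk _ _ (connectingApp_toSatelliteApp F P n X)).Exact := by
  rw [ShortComplex.exact_iff_exact_up_to_refinements]
  intro A x hx
  dsimp only at x hx ⊢
  have hx' : (x ≫ (subStabι F).app (cosyzIter P (n + 1) X)) ≫ satelliteπ F P (n + 1) X = 0 := by
    rw [Category.assoc, ← toSatelliteApp_eq, hx]
  obtain ⟨A', p, hp, y, hy⟩ := (exact_mapπ_satelliteπ F P n X).exact_up_to_refinements _ hx'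
  dsimp only at y hy
  -- The differential factors through `F(Σⁿ⁺¹ X)`, where `y` agrees with a section of `F̄`; the
  -- latter vanishes in `F(Iⁿ⁺¹)`.
  have hy' : y ≫ (mapRes F P X).d n (n + 1) = 0 := by
    rw [← mapπ_mapι, ← reassoc_of% hy, subStabι_mapι, comp_zero, comp_zero]
  refine ⟨A', p, hp, (mapRes F P X).liftCycles y (n + 1) (by simp) hy' ≫
    (mapRes F P X).homologyπ n ≫ (rightDerivedIso F P n X).inv, ?_⟩
  rw [← cancel_mono ((subStabι F).app (cosyzIter P (n + 1) X)), Category.assoc, Category.assoc,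
    Category.assoc, Category.assoc, connectingApp_ι, Iso.inv_hom_id_assoc,
    homologyπ_homologyToCosyz, HomologicalComplex.liftCycles_i_assoc]
  exact hy

/-- A lift to `F(Σⁿ⁺¹ X)` is only determined modulo `F(Iⁿ)`, and this freedom absorbs the boundary.
Degree zero has no boundaries and is just the kernel property of `F̄`. -/
lemma exact_toSatelliteApp_toRightDerived_succ (n : ℕ) (X : C) :
    (ShortComplex.mk _ _ (toSatelliteApp_toRightDerived F P (n + 1) X)).Exact := by
  rw [ShortComplex.exact_iff_exact_up_to_refinements]
  intro A x hx
  dsimp only at x hx ⊢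
  obtain ⟨A₁, p₁, hp₁, y, hy⟩ :=
    surjective_up_to_refinements_of_epi (satelliteπ F P (n + 1) X) x
  have hy₀ : (y ≫ toCycles F P (n + 1) X) ≫ (mapRes F P X).homologyπ (n + 1) = 0 := by
    rw [Category.assoc, ← satelliteπ_toRightDerived, ← reassoc_of% hy, reassoc_of% hx,
      zero_comp, comp_zero]
  obtain ⟨A₂, p₂, hp₂, z, hz⟩ := (ShortComplex.exact_of_g_is_cokernel
    (ShortComplex.mk _ _ ((mapRes F P X).toCycles_comp_homologyπ n (n + 1)))
    ((mapRes F P X).homologyIsCokernel n (n + 1) (by simp))).exact_up_to_refinements _ hy₀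
  dsimp only at z hz
  -- `y` and the image of `z` give the same cycle in `Zⁿ⁺¹`, so their difference lies in `F̄(Σⁿ⁺¹
  -- X)`; the subtracted term dies in `Sⁿ⁺¹F(X)`.
  have hw : (p₂ ≫ y - z ≫ mapπ F P n X) ≫ mapι F P (n + 1) X = 0 := by
    rw [← toCycles_i, ← Category.assoc, Preadditive.sub_comp, Category.assoc, Category.assoc,
      mapπ_toCycles, hz, sub_self, zero_comp]
  have hι : subStabLift F P _ hw ≫ (subStabι F).app (cosyzIter P (n + 1) X) = _ :=
    subStabLift_ι F P _ hw
  refine ⟨A₂, p₂ ≫ p₁, inferInstance, subStabLift F P _ hw, ?_⟩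
  rw [toSatelliteApp_eq, reassoc_of% hι, Category.assoc, hy, Preadditive.sub_comp,
    Category.assoc, Category.assoc, mapπ_satelliteπ, comp_zero, sub_zero]

lemma exact_toRightDerived_connectingApp (hF : HalfExact F) (n : ℕ) (X : C) :
    (ShortComplex.mk _ _ (toRightDerived_connectingApp F P n X)).Exact := by
  rw [ShortComplex.exact_iff_exact_up_to_refinements]
  intro A x hx
  dsimp only at x hx ⊢
  -- Half-exactness enters only here, for `0 ⟶ Σⁿ X ⟶ Iⁿ ⟶ Σⁿ⁺¹ X ⟶ 0`.
  have hS : (ShortComplex.mk _ _ (mapι_mapπ F P n X)).Exact :=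
    hF _ (ShortComplex.ShortExact.mk (S := ShortComplex.mk _ _ (f_iterπ P n X))
      (exact_f_iterπ P n X))
  obtain ⟨A₁, p₁, hp₁, y, hy⟩ := surjective_up_to_refinements_of_epi
    ((mapRes F P X).homologyπ n) (x ≫ (rightDerivedIso F P n X).hom)
  have hy₀ : (y ≫ (mapRes F P X).iCycles n) ≫ mapπ F P n X = 0 := by
    rw [Category.assoc, ← homologyπ_homologyToCosyz, ← reassoc_of% hy, ← connectingApp_ι,
      reassoc_of% hx, zero_comp, comp_zero]
  obtain ⟨A₂, p₂, hp₂, z, hz⟩ := hS.exact_up_to_refinements _ hy₀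
  dsimp only at z hz
  have hz' : p₂ ≫ y = z ≫ toCycles F P n X := by
    rw [← cancel_mono ((mapRes F P X).iCycles n), Category.assoc, Category.assoc, toCycles_i]
    exact hz
  refine ⟨A₂, p₂ ≫ p₁, inferInstance, z ≫ satelliteπ F P n X, ?_⟩
  rw [← cancel_mono (rightDerivedIso F P n X).hom, Category.assoc, Category.assoc, hy,
    Category.assoc, Category.assoc, satelliteπ_toRightDerived, reassoc_of% hz']

/-! ### Exactness as functors, and preservation of epimorphisms or monomorphisms -/

theorem exact_connecting_toSatellite (n : ℕ) :
    (ShortComplex.mk _ _ (connecting_toSatellite F P n)).Exact :=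
  exact_of_exact_evaluation _ (exact_connectingApp_toSatelliteApp F P n)

theorem exact_toSatellite_toRightDerived (n : ℕ) :
    (ShortComplex.mk _ _ (toSatellite_toRightDerived F P n)).Exact :=
  exact_of_exact_evaluation _ fun X => by
    cases n with
    | zero => exact ShortComplex.exact_of_f_is_kernel _ (subStabIsKernel F X)
    | succ n => exact exact_toSatelliteApp_toRightDerived_succ F P n X

theorem exact_toRightDerived_connecting (hF : HalfExact F) (n : ℕ) :
    (ShortComplex.mk _ _ (toRightDerived_connecting F P n)).Exact :=
  exact_of_exact_evaluation _ (exact_toRightDerived_connectingApp F P hF n)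

instance mono_toSatellite_zero : Mono (toSatellite F P 0) := by
  have (X : C) : Mono ((toSatellite F P 0).app X) :=
    inferInstanceAs (Mono ((subStabι F).app X))
  exact NatTrans.mono_of_mono_app _

/-- When `F(I⁰) ⟶ F(Σ X)` is an epimorphism its cokernel `S¹F(X)` vanishes, so the arrow after `β_F`
is zero and exactness at `F̄ ∘ Σ` applies. -/
theorem epi_connecting_zero [F.PreservesEpimorphisms] : Epi (connecting F P 0) := by
  refine (exact_connecting_toSatellite F P 0).epi_f (NatTrans.ext (funext fun X => ?_))
  have : Epi (mapπ F P 0 X) := inferInstanceAs (Epi (F.map (iterπ P 0 X)))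
  have h : satelliteπ F P 1 X = 0 := by
    rw [← cancel_epi (mapπ F P 0 X), mapπ_satelliteπ, comp_zero]
  have h' : toSatelliteApp F P 1 X = 0 := by rw [toSatelliteApp_eq, h, comp_zero]
  exact h'

/-- The composite `F̄(X) ⟶ F(X) ⟶ F(I)` is both zero and a monomorphism. -/
theorem isZero_subStab [F.PreservesMonomorphisms] : IsZero (subStab F) := by
  refine Functor.isZero _ fun X => ?_
  rw [IsZero.iff_id_eq_zero, ← cancel_mono ((subStabι F).app X),
    ← cancel_mono (F.map (Injective.ι X)), Category.assoc, subStabι_map_injective]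
  simp

theorem mono_toRightDerivedZero [F.PreservesMonomorphisms] : Mono F.toRightDerivedZero :=
  Preadditive.mono_of_isZero_kernel _ (isZero_subStab F)

/-! ### `ρ_F` an isomorphism implies left exactness -/

lemma mono_map_presentation [IsIso F.toRightDerivedZero] {X : C} (Q : InjectivePresentation X) :
    Mono (F.map Q.f) := by
  classical
  -- The earlier results refer to a global choice of containers; changing an arbitrary choice at `X`
  -- alone makes them available for `Q`.
  obtain ⟨P, rfl⟩ : ∃ P : ∀ X : C, InjectivePresentation X, P X = Q :=
    ⟨Function.update (fun X => Nonempty.some (EnoughInjectives.presentation X)) X Q, by simp⟩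
  refine Preadditive.mono_of_cancel_zero _ fun t ht => ?_
  rw [← cancel_mono (F.toRightDerivedZero.app X), comp_toRightDerivedZero_eq_zero F P t ht,
    zero_comp]

/-- If `ρ_F` is an isomorphism, then `F(X)` is the kernel of `F(I) ⟶ F(I/X)` for every embedding
of `X` in an injective object `I`. -/
lemma exists_lift_presentation [IsIso F.toRightDerivedZero] {X : C} (Q : InjectivePresentation X)
    {A : D} (x : A ⟶ F.obj Q.J) (hx : x ≫ F.map (cokernel.π Q.f) = 0) :
    ∃ a : A ⟶ F.obj X, a ≫ F.map Q.f = x := by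
  classical
  obtain ⟨P, rfl⟩ : ∃ P : ∀ X : C, InjectivePresentation X, P X = Q :=
    ⟨Function.update (fun X => Nonempty.some (EnoughInjectives.presentation X)) X Q, by simp⟩
  let x' : A ⟶ (mapRes F P X).X 0 := x
  have hx' : x' ≫ mapπ F P 0 X = 0 := hx
  have hxd : x' ≫ (mapRes F P X).d 0 1 = 0 := by
    rw [← mapπ_mapι, reassoc_of% hx', zero_comp]
  let z := (mapRes F P X).liftCycles x' 1 (by simp) hxd
  have hρ : IsIso (toRightDerived F P 0) := inferInstanceAs (IsIso F.toRightDerivedZero)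
  have hπ : IsIso (satelliteπ F P 0 X) := inferInstanceAs (IsIso (𝟙 (F.obj X)))
  -- This is `ρ_F` read as an isomorphism `F(X) ≅ H⁰(F(I•))`. Since `Z⁰ ⟶ H⁰` is a monomorphism,
  -- inverting `e` lifts the cycle `z` to `F(X)`.
  let e : F.obj (cosyzIter P 0 X) ⟶ (mapRes F P X).homology 0 :=
    satelliteπ F P 0 X ≫ (toRightDerived F P 0).app X ≫ (rightDerivedIso F P 0 X).hom
  have he : IsIso e := inferInstance
  let a : A ⟶ F.obj (cosyzIter P 0 X) := z ≫ (mapRes F P X).homologyπ 0 ≫ inv e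
  have ha : a ≫ toCycles F P 0 X = z := by
    rw [← cancel_mono ((mapRes F P X).homologyπ 0), Category.assoc,
      ← satelliteπ_toRightDerived]
    change (z ≫ (mapRes F P X).homologyπ 0 ≫ inv e) ≫ e = _
    rw [Category.assoc, Category.assoc, IsIso.inv_hom_id, Category.comp_id]
  have hax : a ≫ mapι F P 0 X = x' := by
    rw [← toCycles_i, reassoc_of% ha]
    exact (mapRes F P X).liftCycles_i _ _ _ _
  exact ⟨a, hax⟩

/-- If `ρ_F` is an isomorphism, then `F` is left exact. -/
theorem preservesFiniteLimits_of_isIso_toRightDerivedZero [IsIso F.toRightDerivedZero] :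
    PreservesFiniteLimits F := by
  rw [Functor.preservesFiniteLimits_iff_forall_exact_map_and_mono]
  intro S hS
  have := hS.mono_f
  have := hS.epi_g
  let QB : InjectivePresentation S.X₂ := Nonempty.some (EnoughInjectives.presentation S.X₂)
  have hB : Mono (F.map QB.f) := mono_map_presentation F QB
  have hA : Mono (F.map S.f ≫ F.map QB.f) := by
    rw [← F.map_comp]
    -- The container of `S.X₂` also serves as an injective container of `S.X₁`.
    exact mono_map_presentation F ⟨QB.J, inferInstance, S.f ≫ QB.f, inferInstance⟩
  refine ⟨?_, mono_of_mono _ (F.map QB.f)⟩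
  rw [ShortComplex.exact_iff_exact_up_to_refinements]
  -- No refinement is needed, because `exists_lift_presentation` gives genuine lifts.
  suffices h : ∀ {A : D} (b : A ⟶ F.obj S.X₂), b ≫ F.map S.g = 0 →
      ∃ a : A ⟶ F.obj S.X₁, b = a ≫ F.map S.f from fun A b hb =>
    ⟨A, 𝟙 A, inferInstance, (h b hb).choose, (Category.id_comp b).trans (h b hb).choose_spec⟩
  intro A b hb
  have hk : S.f ≫ QB.f ≫ cokernel.π (S.f ≫ QB.f) = 0 := by
    rw [← Category.assoc, cokernel.condition]
  -- The map from `S.X₂` to the quotient of `QB.J` by `S.X₁` factors through `S.X₃`. Hence `b`,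
  -- which dies in `F(S.X₃)`, also dies in `F` of that quotient.
  have hd : S.g ≫ hS.exact.desc _ hk = QB.f ≫ cokernel.π (S.f ≫ QB.f) := hS.exact.g_desc _ _
  obtain ⟨a, ha⟩ := exists_lift_presentation F ⟨QB.J, inferInstance, S.f ≫ QB.f, inferInstance⟩ (b ≫ F.map QB.f) (by
    dsimp only
    rw [Category.assoc, ← F.map_comp, ← hd, F.map_comp, reassoc_of% hb, zero_comp])
  dsimp only at ha
  refine ⟨a, ?_⟩
  rw [← cancel_mono (F.map QB.f), ← ha, Category.assoc, ← F.map_comp]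

end Sequence

end RightFundamental

open RightFundamental in
theorem theorem3p1 {C : Type u} [Category.{v} C] [Abelian C] [EnoughInjectives C]
    (P : ∀ X : C, InjectivePresentation X) (F : C ⥤ AddCommGrpCat.{w}) [F.Additive] :
    -- the sequence is a complex of functors
    (∃ (h₁ : ∀ n : ℕ, toSatellite F P n ≫ toRightDerived F P n = 0)
        (h₂ : ∀ n : ℕ, toRightDerived F P n ≫ connecting F P n = 0)
        (h₃ : ∀ n : ℕ, connecting F P n ≫ toSatellite F P (n + 1) = 0),
      -- it is exact at `F̄`, at `F̄ ∘ Σⁿ⁺¹` and at `SⁿF`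
      Mono (toSatellite F P 0) ∧
      (∀ n : ℕ, (ShortComplex.mk _ _ (h₃ n)).Exact) ∧
      (∀ n : ℕ, (ShortComplex.mk _ _ (h₁ n)).Exact) ∧
      -- it is also exact at `RⁿF` if `F` is half-exact
      (HalfExact F → ∀ n : ℕ, (ShortComplex.mk _ _ (h₂ n)).Exact)) ∧
    (F.PreservesEpimorphisms → Epi (connecting F P 0)) ∧
    (F.PreservesMonomorphisms → IsZero (subStab F) ∧ Mono F.toRightDerivedZero) ∧
    (IsIso F.toRightDerivedZero ↔ PreservesFiniteLimits F) := by
  refine ⟨⟨toSatellite_toRightDerived F P, toRightDerived_connecting F P,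
    connecting_toSatellite F P, inferInstance, exact_connecting_toSatellite F P,
    exact_toSatellite_toRightDerived F P, exact_toRightDerived_connecting F P⟩,
    fun _ => epi_connecting_zero F P,
    fun _ => ⟨isZero_subStab F, mono_toRightDerivedZero F⟩,
    -- That `ρ_F` is an isomorphism for left exact `F` is a Mathlib instance.
    fun _ => preservesFiniteLimits_of_isIso_toRightDerivedZero F, fun _ => inferInstance⟩
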